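/- **Model.** A system has $N$ identical servers, each with its own first-come-first-served queue and an unlimited buffer. Jobs arrive according to a Poisson process of rate $N\lambda/k$; each job consists of $k$ tasks, and task service times are independent and exponentially distributed with rate $1$. The load is $\lambda=1-\beta N^{-\alpha}$ with constants $0<\beta\le 1$ and $0<\alpha<1/2$. When a job arrives, $kd$ distinct queues are sampled uniformly at random (where $kd$ is a positive integer with $kd\le N$; $d$ is the probe overhead) and the batch-filling policy is applied: the $k$ tasks are assigned one by one, each to a shortest queue among the sampled ones, the queue lengths being updated after each assignment (ties are broken arbitrarily). The delay $T$ of a job is the time from its arrival until all of its tasks are completed; its inherent delay $T^*$ is the maximum of the service times of its $k$ tasks. In steady state, i.e. for a job that arrives to a system whose queue lengths follow a stationary distribution of the queue-length Markov chain, *zero queueing delay* means $\mathbb{E}[T-T^*]/\mathbb{E}[T^*]\to 0$ as $N\to\infty$. Here $k=k(N)$ and $d=d(N)$, and all asymptotics are as $N\to\infty$. **Theorem.** Assume that $k=e^{o(\sqrt{\log N})}$ and $k\to\infty$. 1. If $d=e^{o(\log N/\log k)}$, then for all sufficiently large $N$ the queue-length Markov chain has a stationary distribution, and the steady-state job delay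 satisfies $$\mathbb{E}[T]\ge 2\ln k .$$ 2. Consequently, zero queueing delay requires a probe overhead of at least $e^{\Omega(\log N/\log k)}$: for any choice of $d=d(N)$ for which zero queueing delay is achieved in steady state, there is a constant $c>0$ such that $d\ge e^{c\log N/\log k}$ for all sufficiently large $N$. -/

import Mathlib

open Filter Topology MeasureTheory ProbabilityTheory Asymptotics
open scoped ENNReal

noncomputable section

/-- `f = e^{o(g)}` as `N → ∞`. -/
def IsExpLittleO (f g : ℕ → ℝ) : Prop :=
  ∃ e : ℕ → ℝ, e =o[atTop] g ∧ ∀ᶠ N in atTop, f N = Real.exp (e N)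

/-- The load `λ = 1 - β N^{-α}`. -/
def load (α β : ℝ) (N : ℕ) : ℝ := 1 - β * (N : ℝ) ^ (-α)

/-- Numbers of tasks (the one in service included) at each of `N` servers with unlimited buffers. -/
abbrev QueueState (N : ℕ) : Type := Fin N → ℕ

/-- The length of queue `i` when task `j` of a job is about to be assigned, if the job found the
queues in state `q` and task `l` of the job is sent to server `a l`: the tasks are assigned in the
order `0, 1, …, k - 1`. -/
def lengthBefore {N k : ℕ} (q : QueueState N) (a : Fin k → Fin N) (j : Fin k) (i : Fin N) : ℕ :=
  q i + (Finset.univ.filter fun l : Fin k => l < j ∧ a l = i).card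

/-- The state right after all tasks of a job have been assigned according to `a`. -/
def stateAfter {N k : ℕ} (q : QueueState N) (a : Fin k → Fin N) : QueueState N :=
  fun i => q i + (Finset.univ.filter fun l : Fin k => a l = i).card

/-- The assignment `a` fills the sampled set `A` of queues task by task: each task joins a queue
that is shortest in `A` at that moment, queue lengths being updated after each task. -/
def IsBatchFilled {N k : ℕ} (q : QueueState N) (A : Finset (Fin N)) (a : Fin k → Fin N) : Prop :=
  ∀ j : Fin k, a j ∈ A ∧ ∀ i ∈ A, lengthBefore q a j (a j) ≤ lengthBefore q a j i

/-- A version of the batch-filling policy. Batch-filling determines the assignment up to ties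
between shortest queues; `prob q A` is the distribution of the assignment given the state `q` and
the sampled set `A`, so ties may be broken in any, possibly random, way. -/
structure BatchFilling (N k : ℕ) where
  prob : QueueState N → Finset (Fin N) → (Fin k → Fin N) → ℝ≥0∞
  sum_prob : ∀ q A, A.Nonempty → ∑ a, prob q A a = 1
  isBatchFilled : ∀ q A, A.Nonempty → ∀ a, prob q A a ≠ 0 → IsBatchFilled q A a

/-- The mean of `F` over the assignment of a job that finds the state `q`, when `m` queues
are sampled uniformly at random without replacement and are then batch-filled. -/
def assignMean {N k : ℕ} (P : BatchFilling N k) (m : ℕ) (q : QueueState N)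
    (F : (Fin k → Fin N) → ℝ≥0∞) : ℝ≥0∞ :=
  ∑ A ∈ Finset.powersetCard m (Finset.univ : Finset (Fin N)),
    (N.choose m : ℝ≥0∞)⁻¹ * ∑ a, P.prob q A a * F a

/-- Transition rates of the continuous-time Markov chain of queue lengths: jobs of `k` tasks arrive
at rate `N * lam / k`, and every busy server completes a task at rate `1`. -/
def transitionRate {N k : ℕ} (P : BatchFilling N k) (m : ℕ) (lam : ℝ) (q q' : QueueState N) :
    ℝ≥0∞ :=
  ENNReal.ofReal (N * lam / k) * assignMean P m q (fun a => if stateAfter q a = q' then 1 else 0)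
    + ∑ i : Fin N, if 0 < q i ∧ Function.update q i (q i - 1) = q' then 1 else 0

/-- `π` is a stationary distribution of the (bounded-rate) chain: the global balance equations. -/
def IsStationaryDist {N k : ℕ} (P : BatchFilling N k) (m : ℕ) (lam : ℝ) (π : PMF (QueueState N)) :
    Prop :=
  ∀ q, ∑' q', π q * transitionRate P m lam q q' = ∑' q', π q' * transitionRate P m lam q' q

/-- Joint law of the independent rate-`1` exponential (residual) service times; the coordinate
`(i, p)` belongs to the task with exactly `p` tasks ahead of it in queue `i` at the time when a
tagged job has just been assigned. -/
def serviceLaw (N : ℕ) : Measure (Fin N × ℕ → ℝ) :=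
  Measure.infinitePi fun _ => expMeasure 1

/-- The delay `T` of a job that finds the state `q` and is assigned according to `a`, for the
service times `w`: servers are first-come-first-served, so a task completes when it and all tasks
ahead of it in its queue have been served, and the job completes with its last task. -/
def jobDelay {N k : ℕ} (q : QueueState N) (a : Fin k → Fin N) (w : Fin N × ℕ → ℝ) : ℝ :=
  ⨆ j : Fin k, ∑ p ∈ Finset.range (lengthBefore q a j (a j) + 1), w (a j, p)

/-- The inherent delay `T*` of that job: the maximum of the service times of its own tasks. -/
def inherentDelay {N k : ℕ} (q : QueueState N) (a : Fin k → Fin N) (w : Fin N × ℕ → ℝ) : ℝ :=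
  ⨆ j : Fin k, w (a j, lengthBefore q a j (a j))

/-- The expectation of (the nonnegative quantity) `F` for a job that arrives when the
queues are distributed according to `π`. -/
def jobMean {N k : ℕ} (P : BatchFilling N k) (m : ℕ) (π : PMF (QueueState N))
    (F : QueueState N → (Fin k → Fin N) → (Fin N × ℕ → ℝ) → ℝ) : ℝ≥0∞ :=
  ∑' q, π q * assignMean P m q (fun a => ∫⁻ w, ENNReal.ofReal (F q a w) ∂serviceLaw N)

/-- Zero queueing delay: `E[T - T*] / E[T*] → 0` as `N → ∞`. (`T ≥ T*` almost surely.) -/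
def ZeroQueueingDelay (k m : ℕ → ℕ) (P : ∀ N, BatchFilling N (k N))
    (π : ∀ N, PMF (QueueState N)) : Prop :=
  Tendsto (fun N =>
      jobMean (P N) (m N) (π N) (fun q a w => jobDelay q a w - inherentDelay q a w) /
        jobMean (P N) (m N) (π N) inherentDelay)
    atTop (𝓝 0)

end

/-! ### Exponential service times -/

/-! At a load this close to one, short queues are rare, and a small sample seldom finds one. In
steady state, tasks at positions below `M` enter and leave at equal rates. They leave at a rate
equal to the mean number of queues with length in `1, …, M`. They enter, at most `k` per job, only
through jobs that sample a queue shorter than `M`; a union bound over the `m` probes controls these.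
With `s i` the mean number of queues shorter than `i`, this gives `s (i + 1) ≤ s 1 + m * s i`
(`IsStationaryDist.meanShorter_succ_le`). Since at least `N * lam` servers are busy on average, `s 1
≤ N * (1 - lam)`.

Iterating, a job samples a queue shorter than `h` with probability at most `(1 - lam) * (m + 1) ^
h`. For `h = ⌈3 log k⌉` and `m = k * d` the power is `exp (O(log² k + log k * log d))`, a small
power of `N` that `1 - lam ≤ N ^ (-α)` beats. So with probability at least `2/3` the job waits
behind `h` tasks, and `E[T] ≥ 2 log k` (`two_log_le_jobMean`).

As `E[T*] ≤ log k + 1`, such a delay is incompatible with `E[T - T*] / E[T*] → 0`. The bound holds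
at each large `N` with `d ≤ exp (α / 16 * (log N / log k))`, so the second part follows by
contraposition.

Existence is independent of this: `exists_isStationaryDist` applies Foster's criterion to the
uniformized chain, with the sum of squared queue lengths as Lyapunov function. -/

/-- Memorylessness in density form: after a shift by `t`, the excess is integrated by recognizing a
Gamma(2, 1) density of total mass one. -/
lemma exponentialPDF_add_mul_ofReal {t : ℝ} (ht : 0 ≤ t) (y : ℝ) :
    exponentialPDF 1 (y + t) * ENNReal.ofReal y =
      ENNReal.ofReal (Real.exp (-t)) * gammaPDF 2 1 y := by
  rcases lt_or_ge y 0 with hy | hy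
  · simp [gammaPDF_of_neg hy, ENNReal.ofReal_of_nonpos hy.le]
  · rw [exponentialPDF_of_nonneg (by positivity), gammaPDF_of_nonneg hy,
      ← ENNReal.ofReal_mul (by positivity), ← ENNReal.ofReal_mul (by positivity)]
    congr 1
    have : Real.Gamma 2 = 1 := by
      rw [show (2 : ℝ) = 1 + 1 by norm_num, Real.Gamma_add_one one_ne_zero, Real.Gamma_one, mul_one]
    rw [this, show (2 : ℝ) - 1 = 1 by norm_num, neg_mul_eq_neg_mul]
    simp only [Real.rpow_one, Real.one_rpow, one_mul, div_one, neg_one_mul, neg_add, Real.exp_add]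
    ring

/-- The mean excess of a standard exponential variable over the level `t`. -/
lemma lintegral_ofReal_sub_expMeasure {t : ℝ} (ht : 0 ≤ t) :
    ∫⁻ x, ENNReal.ofReal (x - t) ∂expMeasure 1 = ENNReal.ofReal (Real.exp (-t)) := by
  have hpdf : Measurable (exponentialPDF 1) := (measurable_exponentialPDFReal 1).ennreal_ofReal
  have h : expMeasure 1 = volume.withDensity (exponentialPDF 1) := rfl
  rw [h, lintegral_withDensity_eq_lintegral_mul _ hpdf (by fun_prop),
    ← lintegral_add_right_eq_self _ t]
  simp only [Pi.mul_apply, add_sub_cancel_right, exponentialPDF_add_mul_ofReal ht]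
  rw [lintegral_const_mul' _ _ ENNReal.ofReal_ne_top,
    lintegral_gammaPDF_eq_one two_pos one_pos, mul_one]

lemma expMeasure_nonneg_ae : ∀ᵐ x ∂expMeasure 1, 0 ≤ x := by
  have h : expMeasure 1 = volume.withDensity (exponentialPDF 1) := rfl
  rw [ae_iff, h, show {x : ℝ | ¬0 ≤ x} = Set.Iio 0 by ext; simp,
    withDensity_apply _ measurableSet_Iio]
  exact lintegral_exponentialPDF_of_nonpos le_rfl

instance : IsProbabilityMeasure (expMeasure 1) := isProbabilityMeasure_expMeasure one_pos

lemma measurePreserving_eval_serviceLaw {N : ℕ} (x : Fin N × ℕ) :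
    MeasurePreserving (fun w : Fin N × ℕ → ℝ => w x) (serviceLaw N) (expMeasure 1) :=
  measurePreserving_eval_infinitePi (fun _ : Fin N × ℕ => expMeasure 1) x

instance (N : ℕ) : IsProbabilityMeasure (serviceLaw N) := by
  unfold serviceLaw; infer_instance

lemma lintegral_serviceLaw_sub {N : ℕ} (x : Fin N × ℕ) {t : ℝ} (ht : 0 ≤ t) :
    ∫⁻ w, ENNReal.ofReal (w x - t) ∂serviceLaw N = ENNReal.ofReal (Real.exp (-t)) := by
  rw [← lintegral_ofReal_sub_expMeasure ht,
    ← (measurePreserving_eval_serviceLaw x).lintegral_comp (by fun_prop)]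

lemma serviceLaw_nonneg_ae (N : ℕ) : ∀ᵐ w ∂serviceLaw N, ∀ x, 0 ≤ w x :=
  ae_all_iff.2 fun x => (measurePreserving_eval_serviceLaw x).quasiMeasurePreserving.ae
    expMeasure_nonneg_ae

/-- The mean delay of a job is at least that of any of its tasks. -/
lemma le_lintegral_jobDelay {N k : ℕ} (q : QueueState N) (a : Fin k → Fin N) (j : Fin k) :
    (lengthBefore q a j (a j) + 1 : ℝ≥0∞) ≤
      ∫⁻ w, ENNReal.ofReal (jobDelay q a w) ∂serviceLaw N := by
  calc (lengthBefore q a j (a j) + 1 : ℝ≥0∞)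
      = ∑ p ∈ Finset.range (lengthBefore q a j (a j) + 1),
          ∫⁻ w, ENNReal.ofReal (w (a j, p)) ∂serviceLaw N := by
        have h (p : ℕ) : ∫⁻ w, ENNReal.ofReal (w (a j, p)) ∂serviceLaw N = 1 := by
          simpa using lintegral_serviceLaw_sub (a j, p) le_rfl
        simp [h]
    _ = ∫⁻ w, ∑ p ∈ Finset.range (lengthBefore q a j (a j) + 1),
          ENNReal.ofReal (w (a j, p)) ∂serviceLaw N :=
        (lintegral_finsetSum _ fun p _ => by fun_prop).symm
    _ ≤ _ := by
        refine lintegral_mono_ae ?_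
        filter_upwards [serviceLaw_nonneg_ae N] with w hw
        rw [← ENNReal.ofReal_sum_of_nonneg fun p _ => hw _]
        exact ENNReal.ofReal_le_ofReal
          (le_ciSup (f := fun j : Fin k =>
            ∑ p ∈ Finset.range (lengthBefore q a j (a j) + 1), w (a j, p))
            (Set.finite_range _).bddAbove j)

/-- The mean of the maximum of `k` standard exponential variables is at most `1 + log k`. -/
lemma lintegral_inherentDelay_le {N k : ℕ} (hk : 0 < k) (q : QueueState N) (a : Fin k → Fin N) :
    ∫⁻ w, ENNReal.ofReal (inherentDelay q a w) ∂serviceLaw N ≤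
      ENNReal.ofReal (Real.log k + 1) := by
  have hk1 : (1 : ℝ) ≤ k := by exact_mod_cast hk
  have ht : 0 ≤ Real.log k := Real.log_nonneg hk1
  have : Nonempty (Fin k) := ⟨⟨0, hk⟩⟩
  -- The maximum is at most a level plus the sum of all excesses over it; at level `log k` these
  -- have total mean `k * exp (-log k) = 1`.
  calc ∫⁻ w, ENNReal.ofReal (inherentDelay q a w) ∂serviceLaw N
      ≤ ∫⁻ w, (ENNReal.ofReal (Real.log k) + ∑ j : Fin k,
          ENNReal.ofReal (w (a j, lengthBefore q a j (a j)) - Real.log k)) ∂serviceLaw N := by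
        refine lintegral_mono fun w => ?_
        obtain ⟨j, hj⟩ := exists_eq_ciSup_of_finite
          (f := fun j : Fin k => w (a j, lengthBefore q a j (a j)))
        have h : inherentDelay q a w = w (a j, lengthBefore q a j (a j)) := hj.symm
        calc ENNReal.ofReal (inherentDelay q a w)
            = ENNReal.ofReal (Real.log k + (w (a j, lengthBefore q a j (a j)) - Real.log k)) := by
              rw [h, add_sub_cancel]
          _ ≤ _ := ENNReal.ofReal_add_le.trans (by
              gcongr
              exact Finset.single_le_sum
                (f := fun j => ENNReal.ofReal (w (a j, lengthBefore q a j (a j)) - Real.log k))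
                (fun _ _ => zero_le) (Finset.mem_univ j))
    _ = ENNReal.ofReal (Real.log k) + k * ENNReal.ofReal (Real.exp (-Real.log k)) := by
        rw [lintegral_add_left measurable_const,
          lintegral_finsetSum _ fun p _ => by fun_prop]
        simp [lintegral_serviceLaw_sub _ ht]
    _ = _ := by
        rw [Real.exp_neg, Real.exp_log (by positivity), ENNReal.ofReal_add ht zero_le_one,
          ← ENNReal.ofReal_natCast, ← ENNReal.ofReal_mul (by positivity),
          mul_inv_cancel₀ (by positivity)]

/-! ### Means over the sampled queues and over the assignment -/

/-- The mean of `G` over a uniformly random set of `m` queues. -/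
noncomputable def sampleMean {N : ℕ} (m : ℕ) (G : Finset (Fin N) → ℝ≥0∞) : ℝ≥0∞ :=
  ∑ A ∈ Finset.powersetCard m (Finset.univ : Finset (Fin N)), (N.choose m : ℝ≥0∞)⁻¹ * G A

section Sampling

variable {N k m : ℕ}

lemma sampleMean_const (hm : m ≤ N) (x : ℝ≥0∞) :
    sampleMean m (fun _ : Finset (Fin N) => x) = x := by
  have h : (N.choose m : ℝ≥0∞) ≠ 0 := by exact_mod_cast (Nat.choose_pos hm).ne'
  rw [sampleMean, Finset.sum_const, Finset.card_powersetCard, Finset.card_univ, Fintype.card_fin,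
    nsmul_eq_mul, ← mul_assoc, ENNReal.mul_inv_cancel h (ENNReal.natCast_ne_top _), one_mul]

lemma sampleMean_mono {G H : Finset (Fin N) → ℝ≥0∞} (h : ∀ A, A.card = m → G A ≤ H A) :
    sampleMean m G ≤ sampleMean m H :=
  Finset.sum_le_sum fun A hA => mul_le_mul_right (h A (Finset.mem_powersetCard.1 hA).2) _

lemma sampleMean_add (G H : Finset (Fin N) → ℝ≥0∞) :
    sampleMean m (fun A => G A + H A) = sampleMean m G + sampleMean m H := by
  simp [sampleMean, mul_add, Finset.sum_add_distrib]

lemma sampleMean_const_mul (x : ℝ≥0∞) (G : Finset (Fin N) → ℝ≥0∞) :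
    sampleMean m (fun A => x * G A) = x * sampleMean m G := by
  simp only [sampleMean, Finset.mul_sum]
  exact Finset.sum_congr rfl fun A _ => by ring

lemma card_filter_mem_powersetCard (hm : 1 ≤ m) (i : Fin N) :
    ((Finset.powersetCard m (Finset.univ : Finset (Fin N))).filter fun A => i ∈ A).card =
      (N - 1).choose (m - 1) := by
  simpa using Finset.card_filter_powersetCard_subset {i} (Finset.univ : Finset (Fin N)) m
    (by simp) (by simpa using hm)

/-- Every queue is sampled with probability `m / N`. -/
lemma sampleMean_sum (hm : 1 ≤ m) (hmN : m ≤ N) (g : Fin N → ℝ≥0∞) :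
    sampleMean m (fun A => ∑ i ∈ A, g i) = m / N * ∑ i, g i := by
  have hN : 1 ≤ N := hm.trans hmN
  have hc : ((N.choose m : ℕ) : ℝ≥0∞) ≠ 0 := by exact_mod_cast (Nat.choose_pos hmN).ne'
  have hN0 : (N : ℝ≥0∞) ≠ 0 := by exact_mod_cast (by omega : N ≠ 0)
  have hchoose : ((N.choose m : ℕ) : ℝ≥0∞)⁻¹ * ((N - 1).choose (m - 1) : ℕ) = m / N := by
    rw [mul_comm, ← div_eq_mul_inv, ENNReal.div_eq_div_iff hN0 (ENNReal.natCast_ne_top _) hc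
      (ENNReal.natCast_ne_top _)]
    obtain ⟨n, rfl⟩ := Nat.exists_eq_add_of_le' hN
    obtain ⟨l, rfl⟩ := Nat.exists_eq_add_of_le' hm
    have := Nat.add_one_mul_choose_eq n l
    simp only [Nat.add_sub_cancel]
    rw [mul_comm ((n + 1).choose (l + 1) : ℝ≥0∞)]
    exact_mod_cast (this.trans (mul_comm _ _))
  calc sampleMean m (fun A => ∑ i ∈ A, g i)
      = ∑ A ∈ Finset.powersetCard m (Finset.univ : Finset (Fin N)), ∑ i,
          (N.choose m : ℝ≥0∞)⁻¹ * if i ∈ A then g i else 0 := by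
        refine Finset.sum_congr rfl fun A _ => ?_
        rw [← Finset.mul_sum, Finset.sum_ite_mem, Finset.univ_inter]
    _ = ∑ i, (N.choose m : ℝ≥0∞)⁻¹ * ((N - 1).choose (m - 1) * g i) := by
        rw [Finset.sum_comm]
        refine Finset.sum_congr rfl fun i _ => ?_
        rw [← Finset.mul_sum, ← Finset.sum_filter, Finset.sum_const, nsmul_eq_mul,
          card_filter_mem_powersetCard hm]
    _ = _ := by
        rw [Finset.mul_sum]
        exact Finset.sum_congr rfl fun i _ => by rw [← mul_assoc, hchoose]

variable (P : BatchFilling N k) (q : QueueState N)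

lemma assignMean_eq_sampleMean (F : (Fin k → Fin N) → ℝ≥0∞) :
    assignMean P m q F = sampleMean m fun A => ∑ a, P.prob q A a * F a := rfl

/-- A bound valid for every batch-filled assignment survives any tie-breaking. `1 ≤ m` makes the
sample nonempty, so that `prob` is a probability on batch-filled assignments. -/
lemma assignMean_le_sampleMean (hm : 1 ≤ m) {F : (Fin k → Fin N) → ℝ≥0∞}
    {G : Finset (Fin N) → ℝ≥0∞}
    (h : ∀ A a, A.card = m → IsBatchFilled q A a → F a ≤ G A) :
    assignMean P m q F ≤ sampleMean m G := by
  rw [assignMean_eq_sampleMean]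
  refine sampleMean_mono fun A hA => ?_
  have hne : A.Nonempty := Finset.card_pos.1 (by omega)
  calc ∑ a, P.prob q A a * F a ≤ ∑ a, P.prob q A a * G A := by
        refine Finset.sum_le_sum fun a _ => ?_
        by_cases h0 : P.prob q A a = 0
        · simp [h0]
        · exact mul_le_mul_right (h A a hA (P.isBatchFilled q A hne a h0)) _
    _ = G A := by rw [← Finset.sum_mul, P.sum_prob q A hne, one_mul]

lemma sampleMean_le_assignMean (hm : 1 ≤ m) {F : (Fin k → Fin N) → ℝ≥0∞}
    {G : Finset (Fin N) → ℝ≥0∞}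
    (h : ∀ A a, A.card = m → IsBatchFilled q A a → G A ≤ F a) :
    sampleMean m G ≤ assignMean P m q F := by
  rw [assignMean_eq_sampleMean]
  refine sampleMean_mono fun A hA => ?_
  have hne : A.Nonempty := Finset.card_pos.1 (by omega)
  calc G A = ∑ a, P.prob q A a * G A := by rw [← Finset.sum_mul, P.sum_prob q A hne, one_mul]
    _ ≤ _ := by
        refine Finset.sum_le_sum fun a _ => ?_
        by_cases h0 : P.prob q A a = 0
        · simp [h0]
        · exact mul_le_mul_right (h A a hA (P.isBatchFilled q A hne a h0)) _

lemma assignMean_const (hm : 1 ≤ m) (hmN : m ≤ N) (x : ℝ≥0∞) :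
    assignMean P m q (fun _ => x) = x :=
  le_antisymm
    ((assignMean_le_sampleMean P q hm fun _ _ _ _ => le_rfl).trans_eq (sampleMean_const hmN x))
    ((sampleMean_const hmN x).symm.trans_le
      (sampleMean_le_assignMean P q hm fun _ _ _ _ => le_rfl))

lemma assignMean_add (F G : (Fin k → Fin N) → ℝ≥0∞) :
    assignMean P m q (fun a => F a + G a) = assignMean P m q F + assignMean P m q G := by
  simp [assignMean, mul_add, Finset.sum_add_distrib]

lemma assignMean_mono {F G : (Fin k → Fin N) → ℝ≥0∞} (h : ∀ a, F a ≤ G a) :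
    assignMean P m q F ≤ assignMean P m q G := by
  unfold assignMean
  gcongr
  exact h _

lemma tsum_assignMean_stateAfter (f : QueueState N → ℝ≥0∞) :
    ∑' q', assignMean P m q (fun a => if stateAfter q a = q' then 1 else 0) * f q' =
      assignMean P m q fun a => f (stateAfter q a) := by
  simp only [assignMean, Finset.sum_mul, Finset.mul_sum]
  rw [Summable.tsum_finsetSum fun _ _ => ENNReal.summable]
  refine Finset.sum_congr rfl fun A _ => ?_
  rw [Summable.tsum_finsetSum fun _ _ => ENNReal.summable]
  refine Finset.sum_congr rfl fun a _ => ?_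
  rw [tsum_eq_single (stateAfter q a) fun q' hq' => by simp [hq'.symm]]
  simp [mul_assoc]

lemma tsum_transitionRate_mul (lam : ℝ) (f : QueueState N → ℝ≥0∞) :
    ∑' q', transitionRate P m lam q q' * f q' =
      ENNReal.ofReal (N * lam / k) * assignMean P m q (fun a => f (stateAfter q a)) +
        ∑ i, if 0 < q i then f (Function.update q i (q i - 1)) else 0 := by
  simp only [transitionRate, add_mul, mul_assoc]
  rw [ENNReal.tsum_add, ENNReal.tsum_mul_left, tsum_assignMean_stateAfter]
  congr 1
  simp only [Finset.sum_mul]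
  rw [Summable.tsum_finsetSum fun _ _ => ENNReal.summable]
  refine Finset.sum_congr rfl fun i _ => ?_
  rw [tsum_eq_single (Function.update q i (q i - 1)) fun q' hq' => by simp [hq'.symm]]
  by_cases h : 0 < q i <;> simp [h]

/-- The total rate out of a state: the arrival rate plus the number of busy servers. -/
lemma tsum_transitionRate (lam : ℝ) (hm : 1 ≤ m) (hmN : m ≤ N) :
    ∑' q', transitionRate P m lam q q' =
      ENNReal.ofReal (N * lam / k) + ∑ i, if 0 < q i then 1 else 0 := by
  simpa [assignMean_const P q hm hmN] using tsum_transitionRate_mul (m := m) P q lam fun _ => 1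

end Sampling

/-! ### Consequences of stationarity -/

section Truncation

variable {N k : ℕ}

lemma sum_card_filter_assign (a : Fin k → Fin N) :
    ∑ i, (Finset.univ.filter fun l : Fin k => a l = i).card = k := by
  simpa using (Finset.card_eq_sum_card_fiberwise (f := a) (s := Finset.univ) (t := Finset.univ)
    fun _ _ => Finset.mem_coe.2 (Finset.mem_univ _)).symm

/-- The number of tasks in the system that have fewer than `M` tasks ahead of them. -/
def truncatedTasks (M : ℕ) (q : QueueState N) : ℕ := ∑ i, min (q i) M

/-- The increase of `truncatedTasks` when a job is assigned. -/
def truncatedGain (M : ℕ) (q : QueueState N) (a : Fin k → Fin N) : ℕ :=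
  truncatedTasks M (stateAfter q a) - truncatedTasks M q

lemma truncatedTasks_le (M : ℕ) (q : QueueState N) : truncatedTasks M q ≤ N * M := by
  simpa [truncatedTasks] using
    Finset.sum_le_sum fun i (_ : i ∈ Finset.univ) => min_le_right (q i) M

lemma truncatedTasks_stateAfter (M : ℕ) (q : QueueState N) (a : Fin k → Fin N) :
    truncatedTasks M (stateAfter q a) = truncatedTasks M q + truncatedGain M q a :=
  (Nat.add_sub_cancel' (Finset.sum_le_sum fun i _ =>
    min_le_min_right M (Nat.le_add_right (q i) _))).symm

lemma truncatedGain_le (M : ℕ) (q : QueueState N) (a : Fin k → Fin N) :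
    truncatedGain M q a ≤ k := by
  rw [truncatedGain, Nat.sub_le_iff_le_add, truncatedTasks, truncatedTasks]
  nth_rw 2 [← sum_card_filter_assign a]
  rw [← Finset.sum_add_distrib]
  exact Finset.sum_le_sum fun i _ => by simp only [stateAfter]; omega

/-- At so high a level nothing is truncated, even after the arrival. -/
lemma truncatedGain_eq {M : ℕ} {q : QueueState N} (hM : ∑ i, q i + k ≤ M) (a : Fin k → Fin N) :
    truncatedGain M q a = k := by
  have hq (i : Fin N) : q i ≤ ∑ i, q i :=
    Finset.single_le_sum (fun _ _ => Nat.zero_le _) (Finset.mem_univ i)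
  have hc (i : Fin N) : (Finset.univ.filter fun l : Fin k => a l = i).card ≤ k := by
    simpa using Finset.card_filter_le (Finset.univ : Finset (Fin k)) fun l => a l = i
  have h1 : truncatedTasks M q = ∑ i, q i :=
    Finset.sum_congr rfl fun i _ => min_eq_left (by have := hq i; omega)
  have h2 : truncatedTasks M (stateAfter q a) = ∑ i, q i + k := by
    conv_rhs => rw [← sum_card_filter_assign a, ← Finset.sum_add_distrib]
    exact Finset.sum_congr rfl fun i _ => min_eq_left (by
      have := hq i; have := hc i; simp only [stateAfter]; omega)
  rw [truncatedGain, h1, h2, Nat.add_sub_cancel_left]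

lemma truncatedGain_eq_zero {M : ℕ} {q : QueueState N} {A : Finset (Fin N)} {a : Fin k → Fin N}
    (ha : ∀ j, a j ∈ A) (hA : ∀ i ∈ A, M ≤ q i) : truncatedGain M q a = 0 := by
  rw [truncatedGain, Nat.sub_eq_zero_iff_le]
  refine Finset.sum_le_sum fun i _ => ?_
  by_cases hi : i ∈ A
  · have := hA i hi
    omega
  · have : (Finset.univ.filter fun l : Fin k => a l = i) = ∅ :=
      Finset.filter_eq_empty_iff.2 fun l _ h => hi (h ▸ ha l)
    simp [stateAfter, this]

lemma truncatedTasks_update (M : ℕ) {q : QueueState N} {i : Fin N} (hi : 0 < q i) :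
    truncatedTasks M q =
      truncatedTasks M (Function.update q i (q i - 1)) + if q i ≤ M then 1 else 0 := by
  have h (j : Fin N) : min (q j) M = min (Function.update q i (q i - 1) j) M +
      if j = i then (if q i ≤ M then 1 else 0) else 0 := by
    rcases eq_or_ne j i with rfl | hj
    · simp only [Function.update_self, if_true]
      split_ifs <;> omega
    · simp [hj]
  rw [truncatedTasks, Finset.sum_congr rfl fun j _ => h j, Finset.sum_add_distrib,
    Finset.sum_ite_eq' Finset.univ i, if_pos (Finset.mem_univ i)]
  rfl

end Truncation

/-! ### Rate balance, scarcity of short queues, and bounds on the mean delay -/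

section Stationary

variable {N k m : ℕ} {P : BatchFilling N k} {lam : ℝ} {π : PMF (QueueState N)}

/-- Global balance integrated against `f`. Inflow and outflow stay on separate sides, so all terms
are nonnegative and no integrability is needed. -/
lemma IsStationaryDist.tsum_mul (hπ : IsStationaryDist P m lam π) (hm : 1 ≤ m) (hmN : m ≤ N)
    (f : QueueState N → ℝ≥0∞) :
    ∑' q, π q * ((ENNReal.ofReal (N * lam / k) + ∑ i, if 0 < q i then 1 else 0) * f q) =
      ∑' q, π q * (ENNReal.ofReal (N * lam / k) * assignMean P m q (fun a => f (stateAfter q a)) +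
        ∑ i, if 0 < q i then f (Function.update q i (q i - 1)) else 0) := by
  calc _ = ∑' q, (∑' q', π q * transitionRate P m lam q q') * f q := by
        refine tsum_congr fun q => ?_
        rw [ENNReal.tsum_mul_left, tsum_transitionRate P q lam hm hmN, mul_assoc]
    _ = ∑' q, ∑' q', π q' * (transitionRate P m lam q' q * f q) := by
        refine tsum_congr fun q => ?_
        rw [hπ q, ← ENNReal.tsum_mul_right]
        simp only [mul_assoc]
    _ = _ := by
        rw [ENNReal.tsum_comm]
        refine tsum_congr fun q => ?_
        rw [ENNReal.tsum_mul_left, tsum_transitionRate_mul]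

/-- Rate balance: the tasks with fewer than `M` tasks ahead of them leave and enter the system at
the same rate. -/
lemma IsStationaryDist.truncated_balance (hπ : IsStationaryDist P m lam π) (hm : 1 ≤ m)
    (hmN : m ≤ N) (M : ℕ) :
    ∑' q, π q * ∑ i, (if 0 < q i ∧ q i ≤ M then 1 else 0 : ℝ≥0∞) =
      ENNReal.ofReal (N * lam / k) *
        ∑' q, π q * assignMean P m q (fun a => (truncatedGain M q a : ℝ≥0∞)) := by
  set c := ENNReal.ofReal (N * lam / k)
  -- `Y` is the part common to both sides of the balance equation. Truncation bounds it, so its mean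
  -- is finite and can be cancelled.
  set Y : QueueState N → ℝ≥0∞ := fun q => c * truncatedTasks M q +
    ∑ i, if 0 < q i then (truncatedTasks M (Function.update q i (q i - 1)) : ℝ≥0∞) else 0
  have hY : ∑' q, π q * Y q ≠ ∞ := by
    have hle (q : QueueState N) : Y q ≤ c * (N * M : ℕ) + N * (N * M : ℕ) := by
      have : (N : ℝ≥0∞) * (N * M : ℕ) = ∑ _ : Fin N, ((N * M : ℕ) : ℝ≥0∞) := by simp
      rw [this]
      refine add_le_add (mul_le_mul_right (by exact_mod_cast truncatedTasks_le M q) _)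
        (Finset.sum_le_sum fun i _ => ?_)
      split_ifs
      · exact_mod_cast truncatedTasks_le M _
      · exact zero_le
    refine ne_top_of_le_ne_top ?_ (ENNReal.tsum_le_tsum fun q => mul_le_mul_right (hle q) (π q))
    rw [ENNReal.tsum_mul_right, π.tsum_coe, one_mul]
    exact ENNReal.add_ne_top.2 ⟨ENNReal.mul_ne_top ENNReal.ofReal_ne_top (ENNReal.natCast_ne_top _),
      ENNReal.mul_ne_top (ENNReal.natCast_ne_top _) (ENNReal.natCast_ne_top _)⟩
  have h := hπ.tsum_mul hm hmN fun q => (truncatedTasks M q : ℝ≥0∞)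
  have h1 (q : QueueState N) :
      (c + ∑ i, if 0 < q i then 1 else 0) * (truncatedTasks M q : ℝ≥0∞) =
        Y q + ∑ i, if 0 < q i ∧ q i ≤ M then 1 else 0 := by
    simp only [Y]
    rw [add_mul, Finset.sum_mul, add_assoc, ← Finset.sum_add_distrib]
    congr 1
    refine Finset.sum_congr rfl fun i _ => ?_
    by_cases hi : 0 < q i
    · simp only [hi, if_true, true_and, one_mul]
      rw [truncatedTasks_update M hi]
      push_cast
      rfl
    · simp [hi]
  have h2 (q : QueueState N) :
      c * assignMean P m q (fun a => (truncatedTasks M (stateAfter q a) : ℝ≥0∞)) +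
          (∑ i, if 0 < q i then
            (truncatedTasks M (Function.update q i (q i - 1)) : ℝ≥0∞) else 0) =
        Y q + c * assignMean P m q (fun a => (truncatedGain M q a : ℝ≥0∞)) := by
    simp only [Y, truncatedTasks_stateAfter, Nat.cast_add]
    rw [assignMean_add, assignMean_const P q hm hmN]
    ring
  replace h := (tsum_congr fun q => congrArg (π q * ·) (h1 q).symm).trans
    (h.trans (tsum_congr fun q => congrArg (π q * ·) (h2 q)))
  simp only [mul_add, ENNReal.tsum_add] at h
  have := (ENNReal.add_right_inj hY).1 h
  rw [this, ← ENNReal.tsum_mul_left]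
  exact tsum_congr fun q => by ring

/-- The mean number of queues shorter than `i`. -/
noncomputable def meanShorter (π : PMF (QueueState N)) (i : ℕ) : ℝ≥0∞ :=
  ∑' q, π q * ∑ j, if q j < i then 1 else 0

lemma meanShorter_succ (i : ℕ) :
    meanShorter π (i + 1) = meanShorter π 1 +
      ∑' q, π q * ∑ j, (if 0 < q j ∧ q j ≤ i then 1 else 0 : ℝ≥0∞) := by
  rw [meanShorter, meanShorter, ← ENNReal.tsum_add]
  refine tsum_congr fun q => ?_
  rw [← mul_add, ← Finset.sum_add_distrib]
  congr 1
  refine Finset.sum_congr rfl fun j _ => ?_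
  rcases Nat.eq_zero_or_pos (q j) with h | h
  · simp [h]
  · simp [h, h.ne']

lemma ofReal_rate_mul (hk : 0 < k) :
    ENNReal.ofReal (N * lam / k) * k = ENNReal.ofReal (N * lam) := by
  rw [← ENNReal.ofReal_natCast k, ← ENNReal.ofReal_mul' (by positivity),
    div_mul_cancel₀ _ (by positivity)]

/-- In steady state the mean number of busy servers is at least `N * lam`. -/
lemma IsStationaryDist.le_mean_busy (hπ : IsStationaryDist P m lam π) (hm : 1 ≤ m)
    (hmN : m ≤ N) (hk : 0 < k) :
    ENNReal.ofReal (N * lam) ≤ ∑' q, π q * ∑ i, (if 0 < q i then 1 else 0 : ℝ≥0∞) := by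
  have key (s : Finset (QueueState N)) : ∑ q ∈ s, ENNReal.ofReal (N * lam) * π q ≤
      ∑' q, π q * ∑ i, (if 0 < q i then 1 else 0 : ℝ≥0∞) := by
    -- This level exceeds every queue length reachable by one arrival from a state in `s`, so on `s`
    -- the gain is exactly `k`.
    set M := ∑ q ∈ s, ∑ i, q i + k
    calc ∑ q ∈ s, ENNReal.ofReal (N * lam) * π q
        = ENNReal.ofReal (N * lam / k) * ∑ q ∈ s, π q *
            assignMean P m q (fun a => (truncatedGain M q a : ℝ≥0∞)) := by
          rw [Finset.mul_sum]
          refine Finset.sum_congr rfl fun q hq => ?_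
          have hM : ∑ i, q i + k ≤ M := Nat.add_le_add_right
            (Finset.single_le_sum (f := fun q : QueueState N => ∑ i, q i)
              (fun _ _ => Nat.zero_le _) hq) k
          simp only [truncatedGain_eq hM]
          rw [assignMean_const P q hm hmN, ← ofReal_rate_mul hk]
          ring
      _ ≤ ENNReal.ofReal (N * lam / k) * ∑' q, π q *
            assignMean P m q (fun a => (truncatedGain M q a : ℝ≥0∞)) := by
          gcongr
          exact ENNReal.sum_le_tsum s
      _ = ∑' q, π q * ∑ i, (if 0 < q i ∧ q i ≤ M then 1 else 0 : ℝ≥0∞) :=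
          (hπ.truncated_balance hm hmN M).symm
      _ ≤ _ := by
          refine ENNReal.tsum_le_tsum fun q => mul_le_mul_right (Finset.sum_le_sum fun i _ => ?_) _
          by_cases h : 0 < q i <;> simp only [h, true_and, false_and, if_true, if_false, le_refl]
          split_ifs <;> simp
  calc ENNReal.ofReal (N * lam) = ∑' q, ENNReal.ofReal (N * lam) * π q := by
        rw [ENNReal.tsum_mul_left, π.tsum_coe, mul_one]
    _ ≤ _ := ENNReal.summable.tsum_le_of_sum_le key

lemma IsStationaryDist.meanShorter_one_le (hπ : IsStationaryDist P m lam π) (hm : 1 ≤ m)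
    (hmN : m ≤ N) (hk : 0 < k) (hlam : 0 ≤ lam) :
    meanShorter π 1 ≤ ENNReal.ofReal (N * (1 - lam)) := by
  have h : meanShorter π 1 + ∑' q, π q * ∑ i, (if 0 < q i then 1 else 0 : ℝ≥0∞) = N := by
    rw [meanShorter, ← ENNReal.tsum_add]
    have (q : QueueState N) : π q * ∑ j, (if q j < 1 then 1 else 0 : ℝ≥0∞) +
        π q * ∑ i, (if 0 < q i then 1 else 0 : ℝ≥0∞) = π q * N := by
      rw [← mul_add, ← Finset.sum_add_distrib]
      congr 1
      have (i : Fin N) : (if q i < 1 then 1 else 0 : ℝ≥0∞) + (if 0 < q i then 1 else 0) = 1 := by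
        rcases Nat.eq_zero_or_pos (q i) with h | h
        · simp [h]
        · simp [h, h.ne']
      rw [Finset.sum_congr rfl fun i _ => this i]
      simp
    simp only [this]
    rw [ENNReal.tsum_mul_right, π.tsum_coe, one_mul]
  have h2 : meanShorter π 1 + ENNReal.ofReal (N * lam) ≤ N :=
    h ▸ add_le_add_right (hπ.le_mean_busy hm hmN hk) _
  rw [mul_sub, mul_one, ENNReal.ofReal_sub _ (by positivity), ENNReal.ofReal_natCast]
  exact ENNReal.le_sub_of_add_le_right ENNReal.ofReal_ne_top h2

/-- Only a job that samples a queue shorter than `M` puts tasks at positions below `M`. -/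
lemma assignMean_truncatedGain_le (hm : 1 ≤ m) (hmN : m ≤ N) (M : ℕ) (q : QueueState N) :
    assignMean P m q (fun a => (truncatedGain M q a : ℝ≥0∞)) ≤
      m / N * (k * ∑ j, if q j < M then 1 else 0) := by
  rw [Finset.mul_sum, ← sampleMean_sum hm hmN]
  refine assignMean_le_sampleMean P q hm fun A a _ ha => ?_
  by_cases hA : ∃ i ∈ A, q i < M
  · obtain ⟨i, hi, hq⟩ := hA
    calc (truncatedGain M q a : ℝ≥0∞) ≤ k := by exact_mod_cast truncatedGain_le M q a
      _ = k * if q i < M then 1 else 0 := by simp [hq]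
      _ ≤ _ := Finset.single_le_sum (f := fun i => (k : ℝ≥0∞) * if q i < M then 1 else 0)
          (fun _ _ => zero_le) hi
  · push Not at hA
    simp [truncatedGain_eq_zero (fun j => (ha j).1) hA]

/-- By rate balance, the nonempty queues of length at most `i` are counted by the inflow to
positions below `i`. In the union bound the factors `N * lam / k`, `k` and `m / N` multiply to at
most `m`. -/
lemma IsStationaryDist.meanShorter_succ_le (hπ : IsStationaryDist P m lam π) (hm : 1 ≤ m)
    (hmN : m ≤ N) (hk : 0 < k) (hlam1 : lam ≤ 1) (i : ℕ) :
    meanShorter π (i + 1) ≤ meanShorter π 1 + m * meanShorter π i := by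
  rw [meanShorter_succ, hπ.truncated_balance hm hmN]
  refine add_le_add_right ?_ _
  have hN : (N : ℝ≥0∞) ≠ 0 := by exact_mod_cast (by omega : N ≠ 0)
  calc ENNReal.ofReal (N * lam / k) *
        ∑' q, π q * assignMean P m q (fun a => (truncatedGain i q a : ℝ≥0∞))
      ≤ ENNReal.ofReal (N * lam / k) *
        ∑' q, (m / N * k) * (π q * ∑ j, if q j < i then 1 else 0) := by
        refine mul_le_mul_right (ENNReal.tsum_le_tsum fun q => ?_) _
        exact (mul_le_mul_right (assignMean_truncatedGain_le hm hmN i q) _).trans_eq (by ring)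
    _ = ENNReal.ofReal (N * lam) * (m / N) * meanShorter π i := by
        rw [ENNReal.tsum_mul_left, ← ofReal_rate_mul hk, meanShorter]
        ring
    _ ≤ N * (m / N) * meanShorter π i := by
        gcongr
        rw [← ENNReal.ofReal_natCast]
        exact ENNReal.ofReal_le_ofReal (mul_le_of_le_one_right (by positivity) hlam1)
    _ = m * meanShorter π i := by rw [ENNReal.mul_div_cancel hN (ENNReal.natCast_ne_top _)]

lemma IsStationaryDist.meanShorter_le (hπ : IsStationaryDist P m lam π) (hm : 1 ≤ m)
    (hmN : m ≤ N) (hk : 0 < k) (hlam : 0 ≤ lam) (hlam1 : lam ≤ 1) (i : ℕ) :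
    meanShorter π (i + 1) ≤ (m + 1) ^ i * ENNReal.ofReal (N * (1 - lam)) := by
  induction i with
  | zero => simpa using hπ.meanShorter_one_le hm hmN hk hlam
  | succ i ih =>
    set b := ENNReal.ofReal (N * (1 - lam))
    calc meanShorter π (i + 1 + 1) ≤ meanShorter π 1 + m * meanShorter π (i + 1) :=
          hπ.meanShorter_succ_le hm hmN hk hlam1 _
      _ ≤ 1 * b + m * ((m + 1) ^ i * b) := by
          gcongr
          rw [one_mul]
          exact hπ.meanShorter_one_le hm hmN hk hlam
      _ ≤ (m + 1) ^ i * b + m * ((m + 1) ^ i * b) := by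
          gcongr
          exact one_le_pow₀ (by simp)
      _ = _ := by ring

/-- A job waits behind `h` tasks unless it samples a queue shorter than `h`. -/
lemma le_jobMean_jobDelay_add (hm : 1 ≤ m) (hmN : m ≤ N) (hk : 0 < k) (h : ℕ) :
    (h : ℝ≥0∞) ≤ jobMean P m π jobDelay + m / N * (h * meanShorter π h) := by
  have key (q : QueueState N) : (h : ℝ≥0∞) ≤
      assignMean P m q (fun a => ∫⁻ w, ENNReal.ofReal (jobDelay q a w) ∂serviceLaw N) +
        m / N * (h * ∑ j, if q j < h then 1 else 0) := by
    rw [Finset.mul_sum, ← sampleMean_sum hm hmN]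
    -- `G A` reaches `h` once `A` contains a short queue, making the truncated difference `h - G A`
    -- vanish; otherwise the first task already has `h` tasks ahead of it.
    set G : Finset (Fin N) → ℝ≥0∞ := fun A => ∑ i ∈ A, h * if q i < h then 1 else 0
    calc (h : ℝ≥0∞) = sampleMean m (fun _ : Finset (Fin N) => (h : ℝ≥0∞)) :=
          (sampleMean_const hmN _).symm
      _ ≤ sampleMean m (fun A => (h - G A) + G A) := sampleMean_mono fun A _ => le_tsub_add
      _ = sampleMean m (fun A => h - G A) + sampleMean m G := sampleMean_add _ _
      _ ≤ _ := by
          refine add_le_add_left (sampleMean_le_assignMean P q hm fun A a _ ha => ?_) _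
          by_cases hA : ∃ i ∈ A, q i < h
          · obtain ⟨i, hi, hq⟩ := hA
            have : (h : ℝ≥0∞) ≤ G A := by
              calc (h : ℝ≥0∞) = h * if q i < h then 1 else 0 := by simp [hq]
                _ ≤ _ := Finset.single_le_sum
                    (f := fun i => (h : ℝ≥0∞) * if q i < h then 1 else 0) (fun _ _ => zero_le) hi
            rw [tsub_eq_zero_of_le this]
            exact zero_le
          · push Not at hA
            refine tsub_le_self.trans (le_trans ?_ (le_lintegral_jobDelay q a ⟨0, hk⟩))
            have := (hA _ (ha ⟨0, hk⟩).1).trans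
              (Nat.le_add_right (q (a ⟨0, hk⟩)) (Finset.univ.filter fun l : Fin k =>
                l < ⟨0, hk⟩ ∧ a l = a ⟨0, hk⟩).card)
            exact_mod_cast this.trans (Nat.le_succ _)
  calc (h : ℝ≥0∞) = ∑' q, π q * h := by rw [ENNReal.tsum_mul_right, π.tsum_coe, one_mul]
    _ ≤ ∑' q, (π q *
          assignMean P m q (fun a => ∫⁻ w, ENNReal.ofReal (jobDelay q a w) ∂serviceLaw N) +
        (m / N * h) * (π q * ∑ j, if q j < h then 1 else 0)) := by
        gcongr with q
        exact (mul_le_mul_right (key q) _).trans_eq (by ring)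
    _ = _ := by
        rw [ENNReal.tsum_add, ENNReal.tsum_mul_left, mul_assoc]
        rfl

/-- A lower bound for the mean delay in steady state. -/
lemma IsStationaryDist.le_jobMean_jobDelay (hπ : IsStationaryDist P m lam π) (hm : 1 ≤ m)
    (hmN : m ≤ N) (hk : 0 < k) (hlam : 0 ≤ lam) (hlam1 : lam ≤ 1) (h : ℕ) :
    ENNReal.ofReal (h * (1 - (1 - lam) * (m + 1) ^ h)) ≤ jobMean P m π jobDelay := by
  rcases Nat.eq_zero_or_pos h with rfl | hh
  · simp
  obtain ⟨i, rfl⟩ := Nat.exists_eq_add_of_le' hh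
  set h := i + 1
  have hN : 0 < N := by omega
  have h1 : (m : ℝ≥0∞) / N * (h * meanShorter π h) ≤
      ENNReal.ofReal (h * ((1 - lam) * (m + 1) ^ h)) := by
    calc (m : ℝ≥0∞) / N * (h * meanShorter π h)
        ≤ m / N * (h * ((m + 1) ^ i * ENNReal.ofReal (N * (1 - lam)))) := by
          gcongr
          exact hπ.meanShorter_le hm hmN hk hlam hlam1 i
      _ ≤ (m + 1) / N * (h * ((m + 1) ^ i * ENNReal.ofReal (N * (1 - lam)))) := by
          gcongr
          exact le_self_add
      _ = (N / N) * (h * ((m + 1) ^ h * ENNReal.ofReal (1 - lam))) := by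
          rw [ENNReal.ofReal_mul (by positivity), ENNReal.ofReal_natCast, div_eq_mul_inv,
            div_eq_mul_inv, pow_succ]
          ring
      _ = _ := by
          rw [ENNReal.div_self (by exact_mod_cast hN.ne') (ENNReal.natCast_ne_top _), one_mul,
            ENNReal.ofReal_mul (by positivity), ENNReal.ofReal_mul (by linarith),
            ENNReal.ofReal_pow (by positivity), ENNReal.ofReal_natCast,
            ENNReal.ofReal_add (by positivity) zero_le_one, ENNReal.ofReal_natCast,
            ENNReal.ofReal_one]
          ring
  have h0 : 0 ≤ (1 - lam) := by linarith
  rw [mul_sub, mul_one, ENNReal.ofReal_sub _ (by positivity), ENNReal.ofReal_natCast,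
    tsub_le_iff_right]
  exact (le_jobMean_jobDelay_add hm hmN hk h).trans (add_le_add_right h1 _)

lemma jobMean_inherentDelay_le (hm : 1 ≤ m) (hmN : m ≤ N) (hk : 0 < k) :
    jobMean P m π inherentDelay ≤ ENNReal.ofReal (Real.log k + 1) := by
  calc jobMean P m π inherentDelay ≤ ∑' q, π q * ENNReal.ofReal (Real.log k + 1) := by
        refine ENNReal.tsum_le_tsum fun q => mul_le_mul_right ?_ _
        exact (assignMean_mono P q fun a => lintegral_inherentDelay_le hk q a).trans_eq
          (assignMean_const P q hm hmN _)
    _ = _ := by rw [ENNReal.tsum_mul_right, π.tsum_coe, one_mul]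

lemma measurable_inherentDelay (q : QueueState N) (a : Fin k → Fin N) :
    Measurable (inherentDelay q a) :=
  Measurable.iSup fun _ => measurable_pi_apply _

/-- `jobMean` uses the positive part of `T - T*`, so subadditivity suffices and `T ≥ T*` need not be
shown. -/
lemma jobMean_jobDelay_le :
    jobMean P m π jobDelay ≤
      jobMean P m π (fun q a w => jobDelay q a w - inherentDelay q a w) +
        jobMean P m π inherentDelay := by
  rw [jobMean, jobMean, jobMean, ← ENNReal.tsum_add]
  refine ENNReal.tsum_le_tsum fun q => ?_
  rw [← mul_add, ← assignMean_add]
  refine mul_le_mul_right (assignMean_mono P q fun a => ?_) _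
  rw [← lintegral_add_right _ (measurable_inherentDelay q a).ennreal_ofReal]
  refine lintegral_mono fun w => ?_
  simpa using ENNReal.ofReal_add_le (p := jobDelay q a w - inherentDelay q a w)
    (q := inherentDelay q a w)

end Stationary

/-! ### Existence of stationary distributions -/

section Foster

variable {S : Type*}

lemma PMF.tsum_bind_mul (μ : PMF S) (p : S → PMF S) (f : S → ℝ≥0∞) :
    ∑' y, μ.bind p y * f y = ∑' x, μ x * ∑' y, p x y * f y := by
  simp only [PMF.bind_apply, ← ENNReal.tsum_mul_right, ← ENNReal.tsum_mul_left]
  rw [ENNReal.tsum_comm]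
  simp only [mul_assoc]

/-- If `V` has drift at most `C - W`, the time averages of the mean of `W` stay bounded. -/
lemma sum_tsum_iterate_bind_le {p : S → PMF S} {V W : S → ℝ≥0∞} {C : ℝ≥0∞}
    (hdrift : ∀ x, ∑' y, p x y * V y + W x ≤ V x + C) (x₀ : S) (n : ℕ) :
    ∑' x, (fun ν : PMF S => ν.bind p)^[n] (PMF.pure x₀) x * V x +
        ∑ j ∈ Finset.range n, ∑' x, (fun ν : PMF S => ν.bind p)^[j] (PMF.pure x₀) x * W x ≤
      V x₀ + n * C := by
  induction n with
  | zero =>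
    rw [tsum_eq_single x₀ fun x hx => by simp [PMF.pure_apply, hx]]
    simp
  | succ n ih =>
    rw [Finset.sum_range_succ, Function.iterate_succ_apply', PMF.tsum_bind_mul]
    set ν := (fun ν : PMF S => ν.bind p)^[n] (PMF.pure x₀)
    have h : ∑' x, ν x * ∑' y, p x y * V y + ∑' x, ν x * W x ≤ ∑' x, ν x * V x + C := by
      calc _ = ∑' x, ν x * (∑' y, p x y * V y + W x) := by
            rw [← ENNReal.tsum_add]
            simp only [mul_add]
        _ ≤ ∑' x, ν x * (V x + C) := by
            exact ENNReal.tsum_le_tsum fun x => mul_le_mul_right (hdrift x) _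
        _ = _ := by
            simp only [mul_add]
            rw [ENNReal.tsum_add, ENNReal.tsum_mul_right, ν.tsum_coe, one_mul]
    calc _ = (∑' x, ν x * ∑' y, p x y * V y + ∑' x, ν x * W x) +
            ∑ j ∈ Finset.range n,
              ∑' x, (fun ν : PMF S => ν.bind p)^[j] (PMF.pure x₀) x * W x := by ring
      _ ≤ (∑' x, ν x * V x + C) + ∑ j ∈ Finset.range n,
              ∑' x, (fun ν : PMF S => ν.bind p)^[j] (PMF.pure x₀) x * W x := by gcongr
      _ = (∑' x, ν x * V x + ∑ j ∈ Finset.range n,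
              ∑' x, (fun ν : PMF S => ν.bind p)^[j] (PMF.pure x₀) x * W x) + C := by ring
      _ ≤ (V x₀ + n * C) + C := by gcongr
      _ = _ := by push_cast; ring

/-- **Foster's criterion**, for chains in which every state has finitely many predecessors. -/
theorem exists_invariant_pmf {p : S → PMF S} {V W : S → ℝ≥0∞} {C : ℝ≥0∞} (hC : C ≠ ∞)
    (hdrift : ∀ x, ∑' y, p x y * V y + W x ≤ V x + C)
    (hW : ∀ c : ℝ≥0∞, c ≠ ∞ → {x | W x ≤ c}.Finite)
    (hp : ∀ y, {x | p x y ≠ 0}.Finite) (x₀ : S) (hx₀ : V x₀ ≠ ∞) :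
    ∃ π : PMF S, ∀ y, π y = ∑' x, π x * p x y := by
  classical
  set μ : ℕ → PMF S := fun n => (fun ν : PMF S => ν.bind p)^[n] (PMF.pure x₀)
  have hμ (n : ℕ) (y : S) : μ (n + 1) y = ∑' x, μ n x * p x y := by
    simp only [μ, Function.iterate_succ_apply', PMF.bind_apply]
  -- Cesàro averages of the laws started from `x₀`; any limit point is a candidate invariant law.
  set ν : ℕ → S → ℝ≥0∞ := fun n x => ((n + 1 : ℕ) : ℝ≥0∞)⁻¹ * ∑ j ∈ Finset.range (n + 1), μ j x
  have hn0 (n : ℕ) : ((n + 1 : ℕ) : ℝ≥0∞) ≠ 0 := by simp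
  have hnt (n : ℕ) : ((n + 1 : ℕ) : ℝ≥0∞) ≠ ∞ := ENNReal.natCast_ne_top _
  have hνsum (n : ℕ) (f : S → ℝ≥0∞) : ∑' x, ν n x * f x =
      ((n + 1 : ℕ) : ℝ≥0∞)⁻¹ * ∑ j ∈ Finset.range (n + 1), ∑' x, μ j x * f x := by
    simp only [ν, mul_assoc, ENNReal.tsum_mul_left, Finset.sum_mul]
    rw [Summable.tsum_finsetSum fun _ _ => ENNReal.summable]
  have hν1 (n : ℕ) : ∑' x, ν n x = 1 := by
    have := hνsum n fun _ => 1
    simp only [mul_one, (μ _).tsum_coe, Finset.sum_const, Finset.card_range, nsmul_eq_mul] at this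
    rw [this, ENNReal.inv_mul_cancel (hn0 n) (hnt n)]
  set B := V x₀ + C
  have hB : B ≠ ∞ := ENNReal.add_ne_top.2 ⟨hx₀, hC⟩
  have hνW (n : ℕ) : ∑' x, ν n x * W x ≤ B := by
    rw [hνsum]
    calc _ ≤ ((n + 1 : ℕ) : ℝ≥0∞)⁻¹ * (V x₀ + (n + 1 : ℕ) * C) := by
          gcongr
          exact le_add_self.trans (sum_tsum_iterate_bind_le hdrift x₀ (n + 1))
      _ = ((n + 1 : ℕ) : ℝ≥0∞)⁻¹ * V x₀ + C := by
          rw [mul_add, ← mul_assoc, ENNReal.inv_mul_cancel (hn0 n) (hnt n), one_mul]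
      _ ≤ 1 * V x₀ + C := by
          gcongr
          exact ENNReal.inv_le_one.2 (by exact_mod_cast Nat.le_add_left 1 n)
      _ = B := by rw [one_mul]
  -- By compactness of `ℝ≥0∞`, all coordinates converge along one ultrafilter, which replaces a
  -- diagonal extraction.
  set U : Ultrafilter ℕ := hyperfilter ℕ
  have hU : (U : Filter ℕ) ≤ atTop := Nat.hyperfilter_le_atTop
  set π : S → ℝ≥0∞ := fun x => (U.map fun n => ν n x).lim
  have hlim (x : S) : Tendsto (fun n => ν n x) U (𝓝 (π x)) :=
    Ultrafilter.le_nhds_lim (U.map fun n => ν n x)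
  have hlimF (F : Finset S) : Tendsto (fun n => ∑ x ∈ F, ν n x) U (𝓝 (∑ x ∈ F, π x)) :=
    tendsto_finsetSum F fun x _ => hlim x
  have hle : ∑' x, π x ≤ 1 := ENNReal.summable.tsum_le_of_sum_le fun F =>
    le_of_tendsto (hlimF F) (Eventually.of_forall fun n =>
      (ENNReal.sum_le_tsum F).trans_eq (hν1 n))
  -- Tightness by Markov's inequality: the mass outside the finite set `{W ≤ c}` is at most `B / c`.
  -- Large `c` then rules out loss of mass in the limit.
  have htight (c : ℝ≥0∞) (hc : c ≠ ∞) : c ≤ c * ∑' x, π x + B := by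
    set F := (hW c hc).toFinset
    have h1 (n : ℕ) : c ≤ c * ∑ x ∈ F, ν n x + B := by
      calc c = ∑' x, ν n x * c := by rw [ENNReal.tsum_mul_right, hν1, one_mul]
        _ ≤ ∑' x, ((if x ∈ F then ν n x * c else 0) + ν n x * W x) := by
            gcongr with x
            by_cases hx : x ∈ F
            · simp [hx]
            · have : c < W x := by simpa [F] using hx
              simp only [hx, if_false, zero_add]
              gcongr
        _ = (∑ x ∈ F, ν n x * c) + ∑' x, ν n x * W x := by
            rw [ENNReal.tsum_add]
            congr 1
            rw [tsum_eq_sum (s := F) fun x hx => by simp [hx]]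
            exact Finset.sum_congr rfl fun x hx => by simp [hx]
        _ ≤ _ := by
            rw [← Finset.sum_mul, mul_comm c]
            gcongr
            exact hνW n
    have h2 : c ≤ c * ∑ x ∈ F, π x + B :=
      ge_of_tendsto ((ENNReal.Tendsto.const_mul (hlimF F) (Or.inr hc)).add_const B)
        (Eventually.of_forall h1)
    refine h2.trans ?_
    gcongr
    exact ENNReal.sum_le_tsum F
  have hsum : ∑' x, π x = 1 := by
    refine le_antisymm hle (not_lt.1 fun hlt => ?_)
    obtain ⟨n, hn⟩ := ENNReal.exists_nat_mul_gt (tsub_pos_of_lt hlt).ne' hB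
    have h := htight n (ENNReal.natCast_ne_top n)
    nth_rw 1 [← mul_one (n : ℝ≥0∞), ← add_tsub_cancel_of_le hle, mul_add] at h
    have hfin : (n : ℝ≥0∞) * ∑' x, π x ≠ ∞ :=
      ENNReal.mul_ne_top (ENNReal.natCast_ne_top n) (ne_top_of_le_ne_top ENNReal.one_ne_top hle)
    exact absurd ((ENNReal.add_le_add_iff_left hfin).1 h) (not_le.2 hn)
  refine ⟨⟨π, hsum ▸ ENNReal.summable.hasSum⟩, fun y => ?_⟩
  change π y = ∑' x, π x * p x y
  -- Finitely many predecessors reduce the sum to a finite one, which commutes with the limit.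
  have hfinsum (g : S → ℝ≥0∞) : ∑' x, g x * p x y = ∑ x ∈ (hp y).toFinset, g x * p x y :=
    tsum_eq_sum fun x hx => by
      have : p x y = 0 := by simpa using hx
      simp [this]
  have hinv : Tendsto (fun n : ℕ => ((n + 1 : ℕ) : ℝ≥0∞)⁻¹) U (𝓝 0) :=
    (ENNReal.tendsto_inv_nat_nhds_zero.comp (tendsto_add_atTop_nat 1)).mono_left hU
  have hsmall (g : ℕ → ℕ) :
      Tendsto (fun n : ℕ => ((n + 1 : ℕ) : ℝ≥0∞)⁻¹ * μ (g n) y) U (𝓝 0) :=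
    tendsto_of_tendsto_of_tendsto_of_le_of_le tendsto_const_nhds hinv (fun _ => zero_le)
      fun n => mul_le_of_le_one_right' ((μ (g n)).coe_le_one y)
  have hL : Tendsto (fun n => ν n y + ((n + 1 : ℕ) : ℝ≥0∞)⁻¹ * μ (n + 1) y) U (𝓝 (π y + 0)) :=
    (hlim y).add (hsmall fun n => n + 1)
  have hR : Tendsto (fun n => ∑' x, ν n x * p x y + ((n + 1 : ℕ) : ℝ≥0∞)⁻¹ * μ 0 y) U
      (𝓝 (∑' x, π x * p x y + 0)) := by
    refine Tendsto.add ?_ (hsmall fun _ => 0)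
    simp only [hfinsum]
    exact tendsto_finsetSum _ fun x _ => ENNReal.Tendsto.mul_const (hlim x)
      (Or.inr ((p x).apply_ne_top y))
  -- One step of the chain shifts the Cesàro window, changing only its two end terms, which vanish
  -- after division by `n + 1`.
  have heq (n : ℕ) : ν n y + ((n + 1 : ℕ) : ℝ≥0∞)⁻¹ * μ (n + 1) y =
      ∑' x, ν n x * p x y + ((n + 1 : ℕ) : ℝ≥0∞)⁻¹ * μ 0 y := by
    rw [hνsum]
    simp only [ν, ← hμ, ← mul_add]
    rw [← Finset.sum_range_succ (fun j => μ j y), Finset.sum_range_succ' (fun j => μ j y)]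
  have h := tendsto_nhds_unique (hL.congr heq) hR
  rwa [add_zero, add_zero] at h

end Foster

/-! ### Uniformization and the quadratic Lyapunov function -/

section Existence

variable {N k m : ℕ} {P : BatchFilling N k} {lam : ℝ}

/-- The jump probabilities of the chain uniformized at rate `N * lam / k + N`. -/
noncomputable def uniformizedProb (P : BatchFilling N k) (m : ℕ) (lam : ℝ)
    (q q' : QueueState N) : ℝ≥0∞ :=
  (ENNReal.ofReal (N * lam / k) + N)⁻¹ *
    (transitionRate P m lam q q' + if q = q' then ∑ i, if 0 < q i then 0 else 1 else 0)

/-- The self-loop is a fictitious departure from each idle server: since `0 - 1 = 0` in `ℕ`, the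
departure sum runs over all servers without a case split. -/
lemma tsum_uniformizedProb_mul (q : QueueState N) (f : QueueState N → ℝ≥0∞) :
    ∑' q', uniformizedProb P m lam q q' * f q' = (ENNReal.ofReal (N * lam / k) + N)⁻¹ *
      (ENNReal.ofReal (N * lam / k) * assignMean P m q (fun a => f (stateAfter q a)) +
        ∑ i, f (Function.update q i (q i - 1))) := by
  simp only [uniformizedProb, mul_assoc, ENNReal.tsum_mul_left, add_mul]
  rw [ENNReal.tsum_add, tsum_transitionRate_mul, tsum_eq_single q fun q' h => by simp [h.symm],
    if_pos rfl, add_assoc, Finset.sum_mul, ← Finset.sum_add_distrib]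
  congr 2
  refine Finset.sum_congr rfl fun i _ => ?_
  by_cases hi : 0 < q i
  · simp [hi]
  · have h0 : q i = 0 := by omega
    have : Function.update q i (q i - 1) = q := by
      rw [h0, Nat.zero_sub, ← h0, Function.update_eq_self]
    rw [this]
    simp [hi]

lemma tsum_uniformizedProb (hm : 1 ≤ m) (hmN : m ≤ N) (q : QueueState N) :
    ∑' q', uniformizedProb P m lam q q' = 1 := by
  have h := tsum_uniformizedProb_mul (P := P) (m := m) (lam := lam) q fun _ => 1
  have hN : (N : ℝ≥0∞) ≠ 0 := by exact_mod_cast (by omega : N ≠ 0)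
  simp only [mul_one, assignMean_const P q hm hmN, Finset.sum_const, Finset.card_univ,
    Fintype.card_fin, nsmul_eq_mul] at h
  rw [h, ENNReal.inv_mul_cancel (by simp [hN]) (by simp)]

/-- A jump shortens no queue by more than one, so predecessors lie below `q' + 1`. -/
lemma finite_uniformizedProb_ne_zero (q' : QueueState N) :
    {q | uniformizedProb P m lam q q' ≠ 0}.Finite := by
  refine (Set.finite_Iic (fun i => q' i + 1 : Fin N → ℕ)).subset fun q hq i => ?_
  by_contra! hlt
  replace hlt : q' i + 1 < q i := hlt
  refine hq ?_
  have h1 (a : Fin k → Fin N) : stateAfter q a ≠ q' := fun h => by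
    have := congrFun h i
    simp only [stateAfter] at this
    omega
  have h2 (j : Fin N) : Function.update q j (q j - 1) ≠ q' := fun h => by
    have := congrFun h i
    rcases eq_or_ne i j with rfl | hij
    · simp only [Function.update_self] at this
      omega
    · simp only [Function.update_of_ne hij] at this
      omega
  have h3 : q ≠ q' := fun h => by
    rw [h] at hlt
    omega
  simp [uniformizedProb, transitionRate, h1, h2, h3, assignMean]

/-- The Lyapunov function: the sum of the squared queue lengths. -/
def sumSq (q : QueueState N) : ℕ := ∑ i, q i ^ 2

/-- Each chosen queue is at most `k` longer than any sampled one, hence than the sample average. In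
`3 * k ^ 2`, two `k ^ 2` come from this error in the cross term and one from the squared increments.
-/
lemma sumSq_stateAfter_le {q : QueueState N} {A : Finset (Fin N)} {a : Fin k → Fin N}
    (ha : IsBatchFilled q A a) :
    A.card * sumSq (stateAfter q a) ≤
      A.card * sumSq q + 2 * k * ∑ i ∈ A, q i + A.card * (3 * k ^ 2) := by
  set c : Fin N → ℕ := fun i => (Finset.univ.filter fun l : Fin k => a l = i).card
  have hc (i : Fin N) : c i ≤ k := by
    simpa using Finset.card_filter_le (Finset.univ : Finset (Fin k)) fun l => a l = i
  have hcs : ∑ i, c i = k := sum_card_filter_assign a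
  have h1 : sumSq (stateAfter q a) = sumSq q + 2 * ∑ i, q i * c i + ∑ i, c i ^ 2 := by
    simp only [sumSq, Finset.mul_sum, ← Finset.sum_add_distrib]
    exact Finset.sum_congr rfl fun i _ => by simp only [stateAfter, c]; ring
  have h2 : ∑ i, c i ^ 2 ≤ k ^ 2 := by
    calc ∑ i, c i ^ 2 ≤ ∑ i, k * c i :=
          Finset.sum_le_sum fun i _ => by rw [sq]; exact Nat.mul_le_mul_right _ (hc i)
      _ = k ^ 2 := by rw [← Finset.mul_sum, hcs, sq]
  have h3 : ∑ i, q i * c i = ∑ j, q (a j) := by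
    rw [← Finset.sum_fiberwise (Finset.univ : Finset (Fin k)) a fun j => q (a j)]
    refine Finset.sum_congr rfl fun i _ => ?_
    rw [Finset.sum_congr rfl fun j hj => by rw [(Finset.mem_filter.1 hj).2], Finset.sum_const,
      smul_eq_mul, mul_comm]
  have h4 (j : Fin k) : A.card * q (a j) ≤ ∑ i ∈ A, q i + A.card * k := by
    rw [← smul_eq_mul, ← smul_eq_mul, ← Finset.sum_const, ← Finset.sum_const,
      ← Finset.sum_add_distrib]
    refine Finset.sum_le_sum fun i hi => ?_
    have hle := (ha j).2 i hi
    have hcard : (Finset.univ.filter fun l : Fin k => l < j ∧ a l = i).card ≤ k := by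
      simpa using Finset.card_filter_le (Finset.univ : Finset (Fin k)) fun l => l < j ∧ a l = i
    simp only [lengthBefore] at hle
    omega
  have h5 : A.card * ∑ j, q (a j) ≤ k * ∑ i ∈ A, q i + A.card * k ^ 2 := by
    rw [Finset.mul_sum]
    refine (Finset.sum_le_sum fun j _ => h4 j).trans_eq ?_
    simp only [Finset.sum_const, Finset.card_univ, Fintype.card_fin, smul_eq_mul]
    ring
  rw [h1, h3]
  calc A.card * (sumSq q + 2 * ∑ j, q (a j) + ∑ i, c i ^ 2)
      = A.card * sumSq q + 2 * (A.card * ∑ j, q (a j)) + A.card * ∑ i, c i ^ 2 := by ring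
    _ ≤ A.card * sumSq q + 2 * (k * ∑ i ∈ A, q i + A.card * k ^ 2) + A.card * k ^ 2 := by gcongr
    _ = _ := by ring

/-- The sample average has the overall average as its mean, so `m` drops out: up to `3 * k ^ 2`, the
bound is that of uniformly random routing. -/
lemma assignMean_sumSq_le (hm : 1 ≤ m) (hmN : m ≤ N) (q : QueueState N) :
    assignMean P m q (fun a => (sumSq (stateAfter q a) : ℝ≥0∞)) ≤
      sumSq q + 2 * k / N * (∑ i, q i : ℕ) + 3 * k ^ 2 := by
  have hm0 : (m : ℝ≥0∞) ≠ 0 := by exact_mod_cast (by omega : m ≠ 0)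
  have hmt : (m : ℝ≥0∞) ≠ ∞ := ENNReal.natCast_ne_top _
  calc assignMean P m q (fun a => (sumSq (stateAfter q a) : ℝ≥0∞))
      ≤ sampleMean m (fun A => (sumSq q + 3 * k ^ 2 : ℝ≥0∞) +
          (2 * k / m) * ∑ i ∈ A, (q i : ℝ≥0∞)) := by
        refine assignMean_le_sampleMean P q hm fun A a hA ha => ?_
        have h : ((A.card * sumSq (stateAfter q a) : ℕ) : ℝ≥0∞) ≤
            (A.card * sumSq q + 2 * k * ∑ i ∈ A, q i + A.card * (3 * k ^ 2) : ℕ) := by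
          exact_mod_cast sumSq_stateAfter_le ha
        rw [hA] at h
        push_cast at h
        rw [← ENNReal.mul_le_mul_iff_right hm0 hmt]
        refine h.trans_eq ?_
        rw [mul_add, ← mul_assoc (m : ℝ≥0∞) (2 * k / m), ENNReal.mul_div_cancel hm0 hmt]
        ring
    _ = (sumSq q + 3 * k ^ 2) + 2 * k / m * (m / N * ∑ i, (q i : ℝ≥0∞)) := by
        rw [sampleMean_add, sampleMean_const hmN, sampleMean_const_mul, sampleMean_sum hm hmN]
    _ = (sumSq q + 3 * k ^ 2) + (m * (m : ℝ≥0∞)⁻¹) * (2 * k / N * ∑ i, (q i : ℝ≥0∞)) := by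
        simp only [div_eq_mul_inv]
        ring
    _ = _ := by
        rw [ENNReal.mul_inv_cancel hm0 hmt, one_mul]
        push_cast
        ring

lemma sum_sumSq_depart_le (q : QueueState N) :
    ∑ i, sumSq (Function.update q i (q i - 1)) + 2 * ∑ i, q i ≤ N * sumSq q + N := by
  have h (i : Fin N) : sumSq (Function.update q i (q i - 1)) + 2 * q i ≤ sumSq q + 1 := by
    have h1 : sumSq q = q i ^ 2 + ∑ j ∈ Finset.univ.erase i, q j ^ 2 :=
      (Finset.add_sum_erase _ (fun j => q j ^ 2) (Finset.mem_univ i)).symm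
    have h2 : sumSq (Function.update q i (q i - 1)) =
        (q i - 1) ^ 2 + ∑ j ∈ Finset.univ.erase i, q j ^ 2 := by
      rw [sumSq, ← Finset.add_sum_erase _ _ (Finset.mem_univ i), Function.update_self]
      congr 1
      exact Finset.sum_congr rfl fun j hj => by
        rw [Function.update_of_ne (Finset.ne_of_mem_erase hj)]
    rw [h1, h2]
    rcases Nat.eq_zero_or_pos (q i) with h0 | h0
    · simp [h0]
    · obtain ⟨n, hn⟩ := Nat.exists_eq_add_of_le' h0
      rw [hn, Nat.add_sub_cancel]
      nlinarith
  rw [Finset.mul_sum, ← Finset.sum_add_distrib]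
  exact (Finset.sum_le_sum fun i _ => h i).trans_eq (by simp [mul_add])

/-- Below capacity the sum of the squared queue lengths has negative drift. -/
lemma uniformizedProb_drift (hm : 1 ≤ m) (hmN : m ≤ N) (hk : 0 < k) (hlam : 0 ≤ lam)
    (hlam1 : lam ≤ 1) (q : QueueState N) :
    ∑' q', uniformizedProb P m lam q q' * (sumSq q' : ℝ≥0∞) +
        (ENNReal.ofReal (N * lam / k) + N)⁻¹ *
          (2 * ENNReal.ofReal (1 - lam) * (∑ i, q i : ℕ)) ≤
      sumSq q + (ENNReal.ofReal (N * lam / k) + N)⁻¹ *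
        (ENNReal.ofReal (N * lam / k) * (3 * k ^ 2) + N) := by
  have hN0 : (N : ℝ≥0∞) ≠ 0 := by exact_mod_cast (by omega : N ≠ 0)
  set c := ENNReal.ofReal (N * lam / k) with hc
  set s : ℝ≥0∞ := ((∑ i, q i : ℕ) : ℝ≥0∞)
  have hck : c * (2 * k / N) = 2 * ENNReal.ofReal lam := by
    have : c * k = ENNReal.ofReal lam * N := by
      rw [hc, ofReal_rate_mul hk, ENNReal.ofReal_mul (by positivity), ENNReal.ofReal_natCast,
        mul_comm]
    calc c * (2 * k / N) = 2 * (c * k) / N := by simp only [div_eq_mul_inv]; ring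
      _ = 2 * ENNReal.ofReal lam * (N / N) := by rw [this]; simp only [div_eq_mul_inv]; ring
      _ = _ := by rw [ENNReal.div_self hN0 (ENNReal.natCast_ne_top _), mul_one]
  have hsplit : 2 * ENNReal.ofReal lam * s + 2 * ENNReal.ofReal (1 - lam) * s = 2 * s := by
    rw [← add_mul, ← mul_add, ← ENNReal.ofReal_add hlam (by linarith)]
    simp
  have hdep : (∑ i, (sumSq (Function.update q i (q i - 1)) : ℝ≥0∞)) + 2 * s ≤
      N * sumSq q + N := by
    have h := (Nat.cast_le (α := ℝ≥0∞)).2 (sum_sumSq_depart_le q)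
    push_cast at h
    simpa only [s, Nat.cast_sum] using h
  have hinv : (c + N)⁻¹ * (c + N) = 1 := ENNReal.inv_mul_cancel (by simp [hN0]) (by simp [hc])
  have hfin : 2 * ENNReal.ofReal lam * s ≠ ∞ :=
    ENNReal.mul_ne_top (ENNReal.mul_ne_top (by simp) ENNReal.ofReal_ne_top)
      (ENNReal.natCast_ne_top _)
  rw [tsum_uniformizedProb_mul, ← mul_add]
  calc (c + N)⁻¹ * (c * assignMean P m q (fun a => (sumSq (stateAfter q a) : ℝ≥0∞)) +
        ∑ i, (sumSq (Function.update q i (q i - 1)) : ℝ≥0∞) + 2 * ENNReal.ofReal (1 - lam) * s)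
      ≤ (c + N)⁻¹ * ((c + N) * sumSq q + (c * (3 * k ^ 2) + N)) := by
        refine mul_le_mul_right ?_ _
        -- The arrival drift `2 * lam * s` is added to both sides, so that on the left the full
        -- departure drift `2 * s` appears without subtraction.
        rw [← ENNReal.add_le_add_iff_left hfin]
        set D := ∑ i, (sumSq (Function.update q i (q i - 1)) : ℝ≥0∞)
        calc 2 * ENNReal.ofReal lam * s +
              (c * assignMean P m q (fun a => (sumSq (stateAfter q a) : ℝ≥0∞)) + D +
                2 * ENNReal.ofReal (1 - lam) * s)
            = c * assignMean P m q (fun a => (sumSq (stateAfter q a) : ℝ≥0∞)) +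
                (D + 2 * s) := by rw [← hsplit]; ring
          _ ≤ c * (sumSq q + 2 * k / N * s + 3 * k ^ 2) + (N * sumSq q + N) := by
              gcongr
              exact assignMean_sumSq_le hm hmN q
          _ = c * (2 * k / N) * s + ((c + N) * sumSq q + (c * (3 * k ^ 2) + N)) := by ring
          _ = _ := by rw [hck]
    _ = _ := by rw [mul_add, ← mul_assoc, hinv, one_mul]

/-- Below capacity the queue-length chain has a stationary distribution. -/
theorem exists_isStationaryDist (P : BatchFilling N k) (hm : 1 ≤ m) (hmN : m ≤ N) (hk : 0 < k)
    (hlam : 0 ≤ lam) (hlam1 : lam < 1) : ∃ π, IsStationaryDist P m lam π := by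
  have hN0 : (N : ℝ≥0∞) ≠ 0 := by exact_mod_cast (by omega : N ≠ 0)
  set c := ENNReal.ofReal (N * lam / k) with hc
  have hL0 : c + N ≠ 0 := by simp [hN0]
  have hLt : c + N ≠ ∞ := by simp [hc]
  set p : QueueState N → PMF (QueueState N) := fun q =>
    ⟨uniformizedProb P m lam q, tsum_uniformizedProb (P := P) (lam := lam) hm hmN q ▸
      ENNReal.summable.hasSum⟩
  have hp (q q' : QueueState N) : p q q' = uniformizedProb P m lam q q' := rfl
  obtain ⟨π, hπ⟩ := exists_invariant_pmf (p := p)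
    (V := fun q => (sumSq q : ℝ≥0∞))
    (W := fun q => (c + N)⁻¹ * (2 * ENNReal.ofReal (1 - lam) * (∑ i, q i : ℕ)))
    (C := (c + N)⁻¹ * (c * (3 * k ^ 2) + N))
    (ENNReal.mul_ne_top (ENNReal.inv_ne_top.2 hL0) (ENNReal.add_ne_top.2
      ⟨ENNReal.mul_ne_top ENNReal.ofReal_ne_top
        (by exact_mod_cast ENNReal.natCast_ne_top (3 * k ^ 2)), ENNReal.natCast_ne_top _⟩))
    (fun q => uniformizedProb_drift hm hmN hk hlam hlam1.le q)
    (fun x hx => by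
      have hw0 : (c + N)⁻¹ * (2 * ENNReal.ofReal (1 - lam)) ≠ 0 :=
        mul_ne_zero (ENNReal.inv_ne_zero.2 hLt)
          (mul_ne_zero two_ne_zero (ENNReal.ofReal_pos.2 (by linarith)).ne')
      obtain ⟨n, hn⟩ := ENNReal.exists_nat_mul_gt hw0 hx
      refine (Set.finite_Iic (fun _ => n : Fin N → ℕ)).subset fun q hq i => ?_
      by_contra! hlt
      have hs : n ≤ ∑ i, q i :=
        hlt.le.trans (Finset.single_le_sum (fun _ _ => Nat.zero_le _) (Finset.mem_univ i))
      have hs' : (n : ℝ≥0∞) ≤ (∑ i, q i : ℕ) := by exact_mod_cast hs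
      refine absurd (hn.trans_le ?_) (not_lt.2 hq)
      calc (n : ℝ≥0∞) * ((c + N)⁻¹ * (2 * ENNReal.ofReal (1 - lam)))
          ≤ (∑ i, q i : ℕ) * ((c + N)⁻¹ * (2 * ENNReal.ofReal (1 - lam))) := by gcongr
        _ = _ := by ring)
    (fun q' => finite_uniformizedProb_ne_zero q') (fun _ => 0) (ENNReal.natCast_ne_top _)
  refine ⟨π, fun q => ?_⟩
  set busy : ℝ≥0∞ := ∑ i, if 0 < q i then 1 else 0
  set idle : ℝ≥0∞ := ∑ i, if 0 < q i then 0 else 1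
  have hsum : busy + idle = N := by
    rw [← Finset.sum_add_distrib, Finset.sum_congr rfl fun i _ =>
      show (if 0 < q i then 1 else 0 : ℝ≥0∞) + (if 0 < q i then 0 else 1) = 1 by split_ifs <;> simp]
    simp
  have hidle : π q * idle ≠ ∞ := ENNReal.mul_ne_top (π.apply_ne_top q)
    (ne_top_of_le_ne_top (ENNReal.natCast_ne_top N) (hsum ▸ le_add_self))
  -- Adding the finite self-loop flow `π q * idle` to both sides turns global balance into
  -- invariance under the uniformized chain.
  rw [ENNReal.tsum_mul_left, tsum_transitionRate P q lam hm hmN,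
    ← ENNReal.add_left_inj hidle]
  calc π q * (c + busy) + π q * idle = (c + N) * π q := by rw [← hsum]; ring
    _ = (c + N) * ∑' q', (c + N)⁻¹ * (π q' * transitionRate P m lam q' q +
          if q' = q then π q * idle else 0) := by
        conv_lhs => rw [hπ q]
        congr 1
        refine tsum_congr fun q' => ?_
        rw [hp, uniformizedProb]
        rcases eq_or_ne q' q with rfl | h
        · simp only [if_true]
          ring
        · simp only [h, if_false]
          ring
    _ = _ := by
        rw [ENNReal.tsum_mul_left, ← mul_assoc, ENNReal.mul_inv_cancel hL0 hLt, one_mul,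
          ENNReal.tsum_add, tsum_ite_eq]

end Existence

/-! ### Asymptotics -/

section Asymptotic

variable {α β : ℝ} {N : ℕ}

lemma load_nonneg (hα : 0 < α) (hβ : 0 < β) (hβ' : β ≤ 1) (hN : 1 ≤ N) : 0 ≤ load α β N := by
  have h : (N : ℝ) ^ (-α) ≤ 1 :=
    Real.rpow_le_one_of_one_le_of_nonpos (by exact_mod_cast hN) (by linarith)
  have h' : 0 ≤ (N : ℝ) ^ (-α) := by positivity
  unfold load
  nlinarith

lemma load_lt_one (hβ : 0 < β) (hN : 1 ≤ N) : load α β N < 1 := by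
  have : 0 < β * (N : ℝ) ^ (-α) := by positivity
  unfold load
  linarith

lemma one_sub_load_le (hβ' : β ≤ 1) (hN : 1 ≤ N) :
    1 - load α β N ≤ Real.exp (-(α * Real.log N)) := by
  have hN' : (0 : ℝ) < N := by exact_mod_cast hN
  have h : (N : ℝ) ^ (-α) = Real.exp (-(α * Real.log N)) := by
    rw [Real.rpow_def_of_pos hN']
    ring_nf
  rw [load, ← h, sub_sub_cancel]
  exact mul_le_of_le_one_left (by positivity) hβ'

variable {k m : ℕ} {d : ℝ}

lemma sample_le_exp (hk : 1 ≤ Real.log k) (hmd : (m : ℝ) = k * d)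
    (hd : d ≤ Real.exp (α / 16 * (Real.log N / Real.log k))) :
    (m : ℝ) ≤ Real.exp (Real.log k + α / 16 * (Real.log N / Real.log k)) := by
  have hk0 : (0 : ℝ) < k := by
    rcases (Nat.cast_nonneg (α := ℝ) k).eq_or_lt with h | h
    · rw [← h, Real.log_zero] at hk
      linarith
    · exact h
  rw [Real.exp_add, Real.exp_log hk0, hmd]
  gcongr

lemma sample_le_card (hα : 0 < α) (hα' : α < 1 / 2) (hN : 1 ≤ N) (hk : 1 ≤ Real.log k)
    (hsq : 32 * Real.log k ^ 2 ≤ α * Real.log N) (hmd : (m : ℝ) = k * d)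
    (hd : d ≤ Real.exp (α / 16 * (Real.log N / Real.log k))) : m ≤ N := by
  have hN' : (0 : ℝ) < N := by exact_mod_cast hN
  have hL : 0 ≤ Real.log N := Real.log_natCast_nonneg N
  have hdiv : Real.log N / Real.log k ≤ Real.log N := div_le_self hL hk
  have h : (m : ℝ) ≤ N := by
    rw [← Real.exp_log hN']
    refine (sample_le_exp hk hmd hd).trans (Real.exp_le_exp.2 ?_)
    nlinarith
  exact_mod_cast h

/-- The ceiling is at most `4 log k` and `m + 1 ≤ exp x`, where `4 log k * x = 8 log² k + α log N /
4 ≤ α log N / 2`. The load factor leaves `exp (-α log N / 2) ≤ exp (-2) ≤ 1/3`. -/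
lemma one_sub_load_mul_pow_le (hα : 0 < α) (hβ' : β ≤ 1) (hN : 1 ≤ N)
    (hk : 1 ≤ Real.log k) (hsq : 32 * Real.log k ^ 2 ≤ α * Real.log N)
    (hL : 4 ≤ α * Real.log N) (hmd : (m : ℝ) = k * d) (hm : 1 ≤ m)
    (hd : d ≤ Real.exp (α / 16 * (Real.log N / Real.log k))) :
    (1 - load α β N) * ((m : ℝ) + 1) ^ ⌈3 * Real.log k⌉₊ ≤ 1 / 3 := by
  have hm' : (1 : ℝ) ≤ m := by exact_mod_cast hm
  have hL0 : 0 ≤ Real.log N := Real.log_natCast_nonneg N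
  have hh : (⌈3 * Real.log k⌉₊ : ℝ) ≤ 4 * Real.log k := by
    have := (Nat.ceil_lt_add_one (by linarith : 0 ≤ 3 * Real.log k)).le
    linarith
  set x := 2 * Real.log k + α / 16 * (Real.log N / Real.log k) with hx
  have hx0 : 0 ≤ x := by positivity
  have h1 : (m : ℝ) + 1 ≤ Real.exp x := by
    have h2 : (2 : ℝ) ≤ Real.exp (Real.log k) := by
      linarith [Real.add_one_le_exp (Real.log k)]
    calc (m : ℝ) + 1 ≤ 2 * m := by linarith
      _ ≤ Real.exp (Real.log k) * Real.exp (Real.log k + α / 16 * (Real.log N / Real.log k)) := by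
          gcongr
          exact sample_le_exp hk hmd hd
      _ = Real.exp x := by rw [← Real.exp_add, hx]; ring_nf
  have hmul : 4 * Real.log k * x = 8 * Real.log k ^ 2 + α * Real.log N / 4 := by
    rw [hx]
    field_simp
    ring
  calc (1 - load α β N) * ((m : ℝ) + 1) ^ ⌈3 * Real.log k⌉₊
      ≤ Real.exp (-(α * Real.log N)) * Real.exp x ^ ⌈3 * Real.log k⌉₊ := by
        gcongr
        exact one_sub_load_le hβ' hN
    _ = Real.exp (-(α * Real.log N) + ⌈3 * Real.log k⌉₊ * x) := by
        rw [← Real.exp_nat_mul, ← Real.exp_add]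
    _ ≤ Real.exp (-2) := by
        refine Real.exp_le_exp.2 ?_
        have := mul_le_mul_of_nonneg_right hh hx0
        linarith
    _ ≤ 1 / 3 := by
        rw [Real.exp_neg, one_div]
        exact inv_anti₀ (by norm_num) (by linarith [Real.add_one_le_exp (2 : ℝ)])

/-- With few probes the mean delay is at least `2 * log k`. -/
lemma two_log_le_jobMean (hα : 0 < α) (hβ : 0 < β) (hβ' : β ≤ 1)
    (hk : 1 ≤ Real.log k) (hsq : 32 * Real.log k ^ 2 ≤ α * Real.log N)
    (hL : 4 ≤ α * Real.log N) (hmd : (m : ℝ) = k * d) (hm : 1 ≤ m) (hmN : m ≤ N)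
    (hd : d ≤ Real.exp (α / 16 * (Real.log N / Real.log k)))
    {P : BatchFilling N k} {π : PMF (QueueState N)}
    (hπ : IsStationaryDist P m (load α β N) π) :
    ENNReal.ofReal (2 * Real.log k) ≤ jobMean P m π jobDelay := by
  have hN : 1 ≤ N := hm.trans hmN
  have hk0 : 0 < k := by
    rcases Nat.eq_zero_or_pos k with rfl | h
    · simp at hk
      linarith
    · exact h
  -- The factor 3 in the height compensates the loss: `3 * (1 - 1/3) = 2`.
  refine le_trans (ENNReal.ofReal_le_ofReal ?_) (hπ.le_jobMean_jobDelay hm hmN hk0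
    (load_nonneg hα hβ hβ' hN) (load_lt_one hβ hN).le ⌈3 * Real.log k⌉₊)
  have h1 := one_sub_load_mul_pow_le (β := β) hα hβ' hN hk hsq hL hmd hm hd
  have h2 : 3 * Real.log k ≤ ⌈3 * Real.log k⌉₊ := Nat.le_ceil _
  nlinarith

lemma IsExpLittleO.eventually_sq_le {k : ℕ → ℕ} (hα : 0 < α)
    (hk : IsExpLittleO (fun N => (k N : ℝ)) (fun N => √(Real.log N))) :
    ∀ᶠ N : ℕ in atTop, 32 * Real.log (k N) ^ 2 ≤ α * Real.log N := by
  obtain ⟨e, he, hke⟩ := hk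
  filter_upwards [he.bound (show 0 < √(α / 32) by positivity), hke] with N h1 h2
  rw [h2, Real.log_exp]
  have h3 : |e N| ≤ √(α / 32) * √(Real.log N) := by
    simpa [abs_of_nonneg (Real.sqrt_nonneg _)] using h1
  have h4 : |e N| ^ 2 ≤ (√(α / 32) * √(Real.log N)) ^ 2 := by gcongr
  rw [sq_abs, mul_pow, Real.sq_sqrt (by positivity),
    Real.sq_sqrt (Real.log_natCast_nonneg N)] at h4
  linarith

lemma IsExpLittleO.eventually_le {d : ℕ → ℝ} {g : ℕ → ℝ} (hd : IsExpLittleO d g)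
    (hg : ∀ᶠ N in atTop, 0 ≤ g N) {c : ℝ} (hc : 0 < c) :
    ∀ᶠ N in atTop, 0 < d N ∧ d N ≤ Real.exp (c * g N) := by
  obtain ⟨e, he, hde⟩ := hd
  filter_upwards [he.bound hc, hde, hg] with N h1 h2 h3
  rw [h2]
  refine ⟨Real.exp_pos _, Real.exp_le_exp.2 ((le_abs_self _).trans ?_)⟩
  simpa [abs_of_nonneg h3] using h1

end Asymptotic

theorem theorem4 (α β : ℝ) (hα : 0 < α) (hα' : α < 1 / 2) (hβ : 0 < β) (hβ' : β ≤ 1)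
    (k : ℕ → ℕ)
    (hk : IsExpLittleO (fun N => (k N : ℝ)) (fun N => √(Real.log N)))
    (hk' : Tendsto k atTop atTop)
    (P : ∀ N, BatchFilling N (k N))
    (d : ℕ → ℝ) (m : ℕ → ℕ) (hm : ∀ᶠ N : ℕ in atTop, (m N : ℝ) = k N * d N) :
    (IsExpLittleO d (fun N => Real.log N / Real.log (k N)) →
      ∀ᶠ N : ℕ in atTop,
        (∃ π, IsStationaryDist (P N) (m N) (load α β N) π) ∧
        ∀ π, IsStationaryDist (P N) (m N) (load α β N) π →
          ENNReal.ofReal (2 * Real.log (k N)) ≤ jobMean (P N) (m N) π jobDelay) ∧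
    ((∀ᶠ N : ℕ in atTop, 1 ≤ m N ∧ m N ≤ N) →
      ∀ π : ∀ N, PMF (QueueState N),
        (∀ᶠ N : ℕ in atTop, IsStationaryDist (P N) (m N) (load α β N) (π N)) →
        ZeroQueueingDelay k m P π →
        ∃ c : ℝ, 0 < c ∧ ∀ᶠ N : ℕ in atTop, Real.exp (c * (Real.log N / Real.log (k N))) ≤ d N) := by
  -- The final contradiction needs `2 L > (1 + 1/4) * (L + 1)` for `L = log k`, that is `L > 5/3`.
  have hlogk : ∀ᶠ N : ℕ in atTop, 2 ≤ Real.log (k N) :=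
    (Real.tendsto_log_atTop.comp (tendsto_natCast_atTop_atTop.comp hk')).eventually_ge_atTop 2
  have hlogN : ∀ᶠ N : ℕ in atTop, 4 ≤ α * Real.log N :=
    ((Real.tendsto_log_atTop.comp tendsto_natCast_atTop_atTop).const_mul_atTop
      hα).eventually_ge_atTop 4
  have hsq := hk.eventually_sq_le hα
  have hkpos : ∀ᶠ N : ℕ in atTop, 1 ≤ k N := hk'.eventually_ge_atTop 1
  refine ⟨fun hd => ?_, fun hmN π hπ hzero => ⟨α / 16, by positivity, ?_⟩⟩
  · have hd' := hd.eventually_le (c := α / 16) (by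
      filter_upwards [hlogk] with N h
      exact div_nonneg (Real.log_natCast_nonneg N) (by linarith)) (by positivity)
    filter_upwards [hlogk, hlogN, hsq, hkpos, hm, hd', eventually_ge_atTop 1]
      with N h1 h2 h3 h4 h5 ⟨h6, h7⟩ hN
    have hk1 : 1 ≤ Real.log (k N) := by linarith
    have hm1 : 1 ≤ m N := by
      have hk0 : (0 : ℝ) < k N := by exact_mod_cast h4
      have : (0 : ℝ) < m N := by rw [h5]; positivity
      exact_mod_cast this
    have hmN := sample_le_card hα hα' hN hk1 h3 h5 h7
    exact ⟨exists_isStationaryDist (P N) hm1 hmN h4 (load_nonneg hα hβ hβ' hN)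
      (load_lt_one hβ hN), fun π hπ => two_log_le_jobMean hα hβ hβ' hk1 h3 h2 h5 hm1 hmN h7 hπ⟩
  · have hratio : ∀ᶠ N in atTop,
        jobMean (P N) (m N) (π N) (fun q a w => jobDelay q a w - inherentDelay q a w) /
          jobMean (P N) (m N) (π N) inherentDelay < ENNReal.ofReal (1 / 4) :=
      hzero.eventually (gt_mem_nhds (by simp))
    filter_upwards [hlogk, hlogN, hsq, hkpos, hm, hmN, hπ, hratio]
      with N h1 h2 h3 h4 h5 ⟨hm1, hmN⟩ hπ hratio
    by_contra! hd
    have hT := two_log_le_jobMean hα hβ hβ' (by linarith) h3 h2 h5 hm1 hmN hd.le hπ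
    -- The bound `1/4` is finite and nonzero, so the denominator can be cleared without excluding
    -- the values `0` and `∞` for `E[T*]`.
    have hdiff := (ENNReal.div_le_iff_le_mul (Or.inr ENNReal.ofReal_ne_top)
      (Or.inr (by simp))).1 hratio.le
    have hinh : jobMean (P N) (m N) (π N) inherentDelay ≤ ENNReal.ofReal (Real.log (k N) + 1) :=
      jobMean_inherentDelay_le hm1 hmN h4
    have hle : ENNReal.ofReal (2 * Real.log (k N)) ≤
        ENNReal.ofReal (1 / 4 * (Real.log (k N) + 1) + (Real.log (k N) + 1)) := by
      rw [ENNReal.ofReal_add (by linarith) (by linarith),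
        ENNReal.ofReal_mul (p := 1 / 4) (by norm_num)]
      exact hT.trans (jobMean_jobDelay_le.trans
        (add_le_add (hdiff.trans (mul_le_mul_right hinh _)) hinh))
    rw [ENNReal.ofReal_le_ofReal_iff (by linarith)] at hle
    linarith
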